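/- Let $S_1,S_2$ be finite non-empty sets of pure strategies with $m_1$ and $m_2$ elements, let $u_1,u_2:S_1\times S_2\to\mathbb R$ be the payoff functions of a two-player game, and let $k\ge 1$ be an integer, $\beta\in(0,1)$ and $\varepsilon\in[0,1]$. Let $\square(S)=\Delta(S_1)\times\Delta(S_2)\subset\mathbb R^{m_1+m_2}$ be the product of the simplices of mixed strategies, with the Euclidean distance $|x-y|$ and its Borel $\sigma$-field, and let $\mathcal P(\square(S))$ be the set of Borel probability measures on it. For $i\in\{1,2\}$ let $-i$ be the other player. For $\sigma\in\Delta(S_{-i})$ let $BR_i(\sigma)\subset S_i$ be the set of pure strategies that maximize the expected payoff of player $i$ against $\sigma$. For $q\in\Delta(S_{-i})$ let $\widetilde{BR}_i(q)$ be the random element of $S_i$ obtained as follows: with probability $1-\varepsilon$, draw $k$ strategies independently from $q$, let $D\in\Delta(S_{-i})$ be their empirical distribution, and choose an element of $BR_i(D)$ uniformly at random; with probability $\varepsilon$, choose an element of $S_i$ uniformly at random. The Recency Weighted Sampler is the Markov chain on $\square(S)$ with transition kernel $$P\big((p_1,p_2),B\big)=\sum_{s_1\in S_1}\sum_{s_2\in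 S_2}\mathbb P\big(\widetilde{BR}_1(p_2)=s_1\big)\,\mathbb P\big(\widetilde{BR}_2(p_1)=s_2\big)\,1_B\big(\beta p_1+(1-\beta)\mathbf 1_{s_1},\ \beta p_2+(1-\beta)\mathbf 1_{s_2}\big),$$ where $\mathbf 1_{s}$ is the unit vector (vertex of the simplex) of the pure strategy $s$. For $\alpha\ge1$ let $$W_\alpha(\mu,\nu)=\Big(\inf_{\pi}\int |x-y|^\alpha\,\pi(dx,dy)\Big)^{1/\alpha},$$ where the infimum is over all couplings $\pi$ of $\mu$ and $\nu$, be the Wasserstein distance of order $\alpha$ on $\mathcal P(\square(S))$. **Theorem.** If $\varepsilon>0$ and $\beta\in\big(1-\max\{m_1,m_2\}^{-1},1\big)$, then the chain with kernel $P$ is uniformly ergodic, in the following sense: there are a unique $\mu^*_\varepsilon\in\mathcal P(\square(S))$ with $\mu^*_\varepsilon P=\mu^*_\varepsilon$ and a number $\theta\in(0,1)$ such that, for all $\alpha\ge1$, $$\big(W_\alpha(\nu P^n,\mu^*_\varepsilon)\big)^\alpha\le c\,\theta^n\qquad\text{for all }\nu\in\mathcal P(\square(S)),\ n\ge 0,$$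 where $c>0$ is a constant depending only on $\max_{x\in\square(S)}|x|$ and $\alpha$, and $\theta$ does not depend on $\alpha$, $\nu$ or $n$. -/

import Mathlib

open MeasureTheory ProbabilityTheory
open scoped ENNReal

noncomputable section

namespace RWS

section BestReply

variable {A B : Type*} [Fintype A] [Fintype B]

/-- Expected payoff of the own pure strategy `a` against the mixed strategy `σ` of the opponent,
for the payoff function `u` (own strategy first, opponent's strategy second). -/
def expectedPayoff (u : A → B → ℝ) (σ : B → ℝ) (a : A) : ℝ :=
  ∑ b, σ b * u a b

open Classical in
/-- The set of pure best replies to the mixed strategy `σ` of the opponent. -/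
def bestReplies (u : A → B → ℝ) (σ : B → ℝ) : Finset A :=
  Finset.univ.filter fun a => ∀ a', expectedPayoff u σ a' ≤ expectedPayoff u σ a

open Classical in
/-- The probability that `a` is chosen when a best reply to `σ` is drawn uniformly at random
from the set of all best replies. -/
def bestReplyProb (u : A → B → ℝ) (σ : B → ℝ) (a : A) : ℝ :=
  if a ∈ bestReplies u σ then 1 / ((bestReplies u σ).card : ℝ) else 0

open Classical in
/-- The empirical distribution of a sample of `k` plays of the opponent: the weight of `b` is the
number of times that `b` was sampled, divided by `k`. -/
def empirical {k : ℕ} (ω : Fin k → B) : B → ℝ :=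
  fun b => ((Finset.univ.filter fun j => ω j = b).card : ℝ) / k

/-- The probability that the player plays `a`: with probability `1 - ε` she draws `k` plays of the
opponent independently from `p`, and plays a uniformly chosen best reply to the empirical
distribution of the sample; with probability `ε` she plays a uniformly random strategy. -/
def playProb (u : A → B → ℝ) (k : ℕ) (ε : ℝ) (p : B → ℝ) (a : A) : ℝ :=
  (1 - ε) * (∑ ω : Fin k → B, (∏ j, p (ω j)) * bestReplyProb u (empirical ω) a)
    + ε / (Fintype.card A : ℝ)

end BestReply

/-- A finite two-player game (strategy sets `S₁` and `S₂`, payoffs `u₁` and `u₂`) together with the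
parameters of the Recency Weighted Sampler: sample size `k`, recency parameter `β`, error
rate `ε`. -/
structure Model (S₁ S₂ : Type*) where
  u₁ : S₁ → S₂ → ℝ
  u₂ : S₁ → S₂ → ℝ
  k : ℕ
  k_pos : 0 < k
  β : ℝ
  β_mem : β ∈ Set.Ioo (0 : ℝ) 1
  ε : ℝ
  ε_mem : ε ∈ Set.Icc (0 : ℝ) 1

/-- The product `Δ(S₁) × Δ(S₂)` of the two simplices, as a subset of the Euclidean space
`ℝ^(S₁ ⊔ S₂)`; it carries the Euclidean distance and the Borel σ-algebra. -/
abbrev Square (S₁ S₂ : Type*) [Fintype S₁] [Fintype S₂] : Type _ :=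
  {x : EuclideanSpace ℝ (S₁ ⊕ S₂) //
    (fun s => x (Sum.inl s)) ∈ stdSimplex ℝ S₁ ∧ (fun s => x (Sum.inr s)) ∈ stdSimplex ℝ S₂}

section Chain

variable {S₁ S₂ : Type*} [Fintype S₁] [Fintype S₂]

/-- The first component `p₁ ∈ Δ(S₁)` of a state. -/
def Square.p₁ (x : Square S₁ S₂) : S₁ → ℝ := fun s => x.1 (Sum.inl s)

/-- The second component `p₂ ∈ Δ(S₂)` of a state. -/
def Square.p₂ (x : Square S₁ S₂) : S₂ → ℝ := fun s => x.1 (Sum.inr s)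

open Classical in
/-- The state `(β p₁ + (1 - β) 1_{s₁}, β p₂ + (1 - β) 1_{s₂})` that follows the state
`x = (p₁, p₂)` when the strategies `s₁` and `s₂` are played. -/
def Model.next (M : Model S₁ S₂) (x : Square S₁ S₂) (s₁ : S₁) (s₂ : S₂) : Square S₁ S₂ :=
  ⟨WithLp.toLp 2 (Sum.elim
      (M.β • x.p₁ + (1 - M.β) • (Pi.single s₁ 1 : S₁ → ℝ))
      (M.β • x.p₂ + (1 - M.β) • (Pi.single s₂ 1 : S₂ → ℝ))),
    by
      have h := convex_stdSimplex ℝ S₁ x.2.1 (single_mem_stdSimplex ℝ s₁) M.β_mem.1.le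
        (sub_nonneg.2 M.β_mem.2.le) (by ring)
      exact h,
    by
      have h := convex_stdSimplex ℝ S₂ x.2.2 (single_mem_stdSimplex ℝ s₂) M.β_mem.1.le
        (sub_nonneg.2 M.β_mem.2.le) (by ring)
      exact h⟩

/-- The probability that `(s₁, s₂)` is played in the state `x`; the two players sample and choose
independently of each other, each from the record of the opposing role. -/
def Model.profileProb (M : Model S₁ S₂) (x : Square S₁ S₂) (s₁ : S₁) (s₂ : S₂) : ℝ :=
  playProb M.u₁ M.k M.ε x.p₂ s₁ * playProb (fun b a => M.u₂ a b) M.k M.ε x.p₁ s₂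

theorem Model.measurable_next (M : Model S₁ S₂) (s₁ : S₁) (s₂ : S₂) :
    Measurable fun x => M.next x s₁ s₂ := by
  refine Continuous.measurable ?_
  refine Continuous.subtype_mk ?_ _
  refine (PiLp.continuous_toLp 2 _).comp (continuous_pi ?_)
  rintro (s | s) <;> simp only [Sum.elim_inl, Sum.elim_inr, Pi.add_apply, Pi.smul_apply,
    Square.p₁, Square.p₂] <;> fun_prop

theorem Model.measurable_profileProb (M : Model S₁ S₂) (s₁ : S₁) (s₂ : S₂) :
    Measurable fun x => M.profileProb x s₁ s₂ := by
  refine Continuous.measurable ?_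
  unfold Model.profileProb playProb Square.p₁ Square.p₂
  fun_prop

/-- The transition kernel of the Recency Weighted Sampler:
`P(x, B) = ∑ s₁, ∑ s₂, ℙ(s₁ and s₂ are played in x) 1_B(next state)`. -/
def Model.kernel (M : Model S₁ S₂) : Kernel (Square S₁ S₂) (Square S₁ S₂) where
  toFun x := ∑ s₁, ∑ s₂, ENNReal.ofReal (M.profileProb x s₁ s₂) • Measure.dirac (M.next x s₁ s₂)
  measurable' := by
    refine Measure.measurable_of_measurable_coe _ fun t ht => ?_
    simp only [Measure.coe_finsetSum, Finset.sum_apply, Measure.smul_apply, smul_eq_mul]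
    refine Finset.measurable_fun_sum _ fun s₁ _ => Finset.measurable_fun_sum _ fun s₂ _ => ?_
    exact (M.measurable_profileProb s₁ s₂).ennreal_ofReal.mul
      ((Measure.measurable_coe ht).comp
        (Measure.measurable_dirac.comp (M.measurable_next s₁ s₂)))

end Chain

/-- The Wasserstein distance of order `q` between two measures on a metric space:
`W_q(μ, ν) = (inf_π ∫ d(x, y)^q dπ(x, y))^(1/q)`, with the infimum over all couplings `π` of `μ`
and `ν`. -/
def wasserstein {X : Type*} [PseudoEMetricSpace X] [MeasurableSpace X] (q : ℝ)
    (μ ν : Measure X) : ℝ≥0∞ :=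
  (⨅ (π : Measure (X × X)) (_ : π.map Prod.fst = μ ∧ π.map Prod.snd = ν),
    ∫⁻ z, edist z.1 z.2 ^ q ∂π) ^ (1 / q)

end RWS

end

/-! The chain is an iterated function system: a profile is drawn with state-dependent probabilities,
then a `β`-contraction is applied. The probabilities are polynomial in the state, hence Lipschitz,
and errors keep them above some `δ > 0`. Two copies are run with maximally coupled profiles, and `V
= min 1 (K d)` is followed along the pair. For close pairs, agreement shrinks `d` by `β`, while
disagreement has probability of order `d`, which a large `K` makes cheap: one step contracts `V`
(`transfer_pair_truncDist_le`). For distant pairs, `N` agreements in a row have probability at least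
`δ ^ N` and bring the pair close, so `V` drops by a fixed factor
(`transfer_pair_iterate_truncDist_le`). Together these give geometric decay of `V`
(`exists_transfer_pair_iterate_le`), uniformly in the starting pair.

As `d ≤ D V`, laws from any two initial laws merge at rate `θ ^ n` (`exists_mixesGeometrically`).
Existence of an invariant law follows by compactness and the Feller property, uniqueness by merging;
`d ^ α ≤ D ^ (α - 1) d` gives all orders `α` with the same `θ`. -/

noncomputable section

namespace RWS

/-! ### Maximal coupling of two probability vectors -/

section MaximalCoupling

variable {S : Type*} [Fintype S]

/-- The common mass of two weight vectors. -/
def overlap (a b : S → ℝ) : ℝ := ∑ s, min (a s) (b s)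

open Classical in
/-- The maximal coupling of two probability vectors: the common mass sits on the diagonal and the
remaining masses are coupled independently. -/
def maximalCoupling (a b : S → ℝ) (i : S × S) : ℝ :=
  (if i.1 = i.2 then min (a i.1) (b i.1) else 0) +
    (a i.1 - min (a i.1) (b i.1)) * (b i.2 - min (a i.2) (b i.2)) / (1 - overlap a b)

variable {a b : S → ℝ}

theorem sum_sub_min_left (ha : ∑ s, a s = 1) :
    ∑ s, (a s - min (a s) (b s)) = 1 - overlap a b := by
  rw [Finset.sum_sub_distrib, ha, overlap]

theorem sum_sub_min_right (hb : ∑ s, b s = 1) :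
    ∑ s, (b s - min (a s) (b s)) = 1 - overlap a b := by
  rw [Finset.sum_sub_distrib, hb, overlap]

theorem overlap_le_one (ha : ∑ s, a s = 1) : overlap a b ≤ 1 := by
  rw [← ha]; exact Finset.sum_le_sum fun s _ => min_le_left _ _

theorem maximalCoupling_nonneg (ha0 : ∀ s, 0 ≤ a s) (hb0 : ∀ s, 0 ≤ b s) (ha : ∑ s, a s = 1)
    (i : S × S) : 0 ≤ maximalCoupling a b i := by
  unfold maximalCoupling
  refine add_nonneg ?_ (div_nonneg (mul_nonneg ?_ ?_) (sub_nonneg.2 (overlap_le_one ha)))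
  · split_ifs
    · exact le_min (ha0 _) (hb0 _)
    · exact le_rfl
  · exact sub_nonneg.2 (min_le_left _ _)
  · exact sub_nonneg.2 (min_le_right _ _)

/-- Covers the degenerate case in which `maximalCoupling` divides by zero: nonnegative residuals
with total mass zero all vanish, so the marginals remain correct. -/
theorem sub_min_eq_zero_left (ha : ∑ s, a s = 1) (h : 1 - overlap a b = 0) (s : S) :
    a s - min (a s) (b s) = 0 := by
  rw [← sum_sub_min_left ha] at h
  exact (Finset.sum_eq_zero_iff_of_nonneg
    fun s _ => sub_nonneg.2 (min_le_left _ _)).1 h s (Finset.mem_univ s)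

theorem sub_min_eq_zero_right (hb : ∑ s, b s = 1) (h : 1 - overlap a b = 0) (s : S) :
    b s - min (a s) (b s) = 0 := by
  rw [← sum_sub_min_right hb] at h
  exact (Finset.sum_eq_zero_iff_of_nonneg
    fun s _ => sub_nonneg.2 (min_le_right _ _)).1 h s (Finset.mem_univ s)

theorem sum_maximalCoupling_snd (ha : ∑ s, a s = 1) (hb : ∑ s, b s = 1) (s : S) :
    ∑ t, maximalCoupling a b (s, t) = a s := by
  classical
  simp only [maximalCoupling, Finset.sum_add_distrib, Finset.sum_ite_eq, Finset.mem_univ, if_true]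
  rw [← Finset.sum_div, ← Finset.mul_sum, sum_sub_min_right hb]
  by_cases h : 1 - overlap a b = 0
  · have := sub_min_eq_zero_left ha h s
    rw [h, mul_zero, zero_div]; linarith
  · rw [mul_div_cancel_right₀ _ h]; ring

theorem sum_maximalCoupling_fst (ha : ∑ s, a s = 1) (hb : ∑ s, b s = 1) (t : S) :
    ∑ s, maximalCoupling a b (s, t) = b t := by
  classical
  simp only [maximalCoupling, Finset.sum_add_distrib, Finset.sum_ite_eq', Finset.mem_univ, if_true]
  rw [← Finset.sum_div, ← Finset.sum_mul, sum_sub_min_left ha]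
  by_cases h : 1 - overlap a b = 0
  · have := sub_min_eq_zero_right hb h t
    rw [h, zero_mul, zero_div]; linarith
  · rw [mul_div_cancel_left₀ _ h]; ring

/-- The residual part has total mass `1 - overlap a b`, and on it `h` is replaced by its upper bound
1. -/
theorem sum_maximalCoupling_mul_le (ha : ∑ s, a s = 1) (hb : ∑ s, b s = 1) {h : S × S → ℝ}
    (h1 : ∀ i, h i ≤ 1) :
    ∑ i, maximalCoupling a b i * h i
      ≤ ∑ s, min (a s) (b s) * h (s, s) + (1 - overlap a b) := by
  classical
  have hres : ∑ i : S × S, (a i.1 - min (a i.1) (b i.1)) * (b i.2 - min (a i.2) (b i.2))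
      / (1 - overlap a b) = 1 - overlap a b := by
    rw [← Finset.sum_div, Fintype.sum_prod_type]
    simp only [← Finset.mul_sum, ← Finset.sum_mul]
    rw [sum_sub_min_right hb, sum_sub_min_left ha, mul_self_div_self]
  calc ∑ i, maximalCoupling a b i * h i
      ≤ ∑ i : S × S, ((if i.1 = i.2 then min (a i.1) (b i.1) else 0) * h i +
        (a i.1 - min (a i.1) (b i.1)) * (b i.2 - min (a i.2) (b i.2)) / (1 - overlap a b)) := by
        refine Finset.sum_le_sum fun i _ => ?_
        have h0 : 0 ≤ (a i.1 - min (a i.1) (b i.1)) * (b i.2 - min (a i.2) (b i.2))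
            / (1 - overlap a b) :=
          div_nonneg (mul_nonneg (sub_nonneg.2 (min_le_left _ _))
            (sub_nonneg.2 (min_le_right _ _))) (sub_nonneg.2 (overlap_le_one ha))
        have e : maximalCoupling a b i = (if i.1 = i.2 then min (a i.1) (b i.1) else 0) +
            (a i.1 - min (a i.1) (b i.1)) * (b i.2 - min (a i.2) (b i.2))
              / (1 - overlap a b) := by
          unfold maximalCoupling; congr
        rw [e, add_mul]
        gcongr
        exact mul_le_of_le_one_right h0 (h1 i)
    _ = _ := by
        rw [Finset.sum_add_distrib, hres, Fintype.sum_prod_type]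
        congr 1
        refine Finset.sum_congr rfl fun s _ => ?_
        simp only [ite_mul, zero_mul, Finset.sum_ite_eq, Finset.mem_univ, if_true]

end MaximalCoupling

/-! ### Transfer operators and geometric decay -/

section Transfer

/-- The transfer operator of the iterated function system with maps `G i` and place-dependent
weights `w i`. -/
def transfer {Y I : Type*} [Fintype I] (w : I → Y → ℝ) (G : I → Y → Y) (f : Y → ℝ) (y : Y) : ℝ :=
  ∑ i, w i y * f (G i y)

variable {Y I : Type*} [Fintype I] {w : I → Y → ℝ} {G : I → Y → Y}

theorem transfer_mono (hw : ∀ i y, 0 ≤ w i y) : Monotone (transfer w G) :=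
  fun _ _ hfg y => Finset.sum_le_sum fun i _ => mul_le_mul_of_nonneg_left (hfg _) (hw i y)

theorem transfer_iterate_nonneg (hw : ∀ i y, 0 ≤ w i y) {f : Y → ℝ} (hf : ∀ y, 0 ≤ f y) (n : ℕ)
    (y : Y) : 0 ≤ (transfer w G)^[n] f y := by
  induction n generalizing y with
  | zero => exact hf y
  | succ n ih =>
    rw [Function.iterate_succ_apply']
    exact Finset.sum_nonneg fun i _ => mul_nonneg (hw i y) (ih _)

theorem transfer_smul (c : ℝ) (f : Y → ℝ) : transfer w G (c • f) = c • transfer w G f := by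
  funext y
  simp only [transfer, Pi.smul_apply, smul_eq_mul, Finset.mul_sum]
  exact Finset.sum_congr rfl fun i _ => by ring

theorem transfer_iterate_smul (c : ℝ) (f : Y → ℝ) (n : ℕ) :
    (transfer w G)^[n] (c • f) = c • (transfer w G)^[n] f := by
  induction n with
  | zero => rfl
  | succ n ih => rw [Function.iterate_succ_apply', ih, transfer_smul, Function.iterate_succ_apply']

/-- An `N`-step contraction yields geometric decay of all iterates. -/
theorem transfer_iterate_le_of_contraction (hw : ∀ i y, 0 ≤ w i y) {V : Y → ℝ}
    (hV1 : ∀ y, V y ≤ 1) (hV : transfer w G V ≤ V) {N : ℕ}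
    (hN : 0 < N) {ρ : ℝ} (hρ : ρ ∈ Set.Ico (1 / 2 : ℝ) 1)
    (hc : (transfer w G)^[N] V ≤ ρ • V) :
    ∃ θ ∈ Set.Ioo (0 : ℝ) 1, ∀ n y, (transfer w G)^[n] V y ≤ 2 * θ ^ n := by
  have hρ0 : 0 < ρ := lt_of_lt_of_le (by norm_num) hρ.1
  have hmono := transfer_mono (G := G) hw
  have hdecr : ∀ j, (transfer w G)^[j] V ≤ V := fun j => by
    induction j with
    | zero => exact le_rfl
    | succ j ih =>
      rw [Function.iterate_succ_apply']
      exact (hmono ih).trans hV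
  have hblock : ∀ m, (transfer w G)^[N * m] V ≤ ρ ^ m • V := fun m => by
    induction m with
    | zero => simp
    | succ m ih =>
      rw [Nat.mul_succ, Nat.add_comm, Function.iterate_add_apply]
      refine ((hmono.iterate N) ih).trans ?_
      rw [transfer_iterate_smul, pow_succ, mul_smul]
      exact smul_le_smul_of_nonneg_left hc (pow_nonneg hρ0.le m)
  -- The rate is the `N`-th root of `ρ`. Rounding `n` down to a multiple of `N` loses at most one
  -- factor `ρ`, which the constant 2 absorbs because `ρ ≥ 1/2`.
  have hθN : (ρ ^ ((N : ℝ)⁻¹)) ^ N = ρ := Real.rpow_inv_natCast_pow hρ0.le hN.ne'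
  have hθ0 : 0 < ρ ^ ((N : ℝ)⁻¹) := Real.rpow_pos_of_pos hρ0 _
  have hθ1 : ρ ^ ((N : ℝ)⁻¹) < 1 :=
    Real.rpow_lt_one hρ0.le hρ.2 (inv_pos.2 (Nat.cast_pos.2 hN))
  refine ⟨ρ ^ ((N : ℝ)⁻¹), ⟨hθ0, hθ1⟩, fun n y => ?_⟩
  generalize ρ ^ ((N : ℝ)⁻¹) = θ at *
  have h1 : (transfer w G)^[n] V y ≤ ρ ^ (n / N) := by
    conv_lhs => rw [← Nat.div_add_mod n N, Function.iterate_add_apply]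
    refine ((hmono.iterate (N * (n / N))) (hdecr (n % N)) y).trans ((hblock (n / N) y).trans ?_)
    simp only [Pi.smul_apply, smul_eq_mul]
    exact mul_le_of_le_one_right (pow_nonneg hρ0.le _) (hV1 y)
  have h2 : ρ ^ (n / N + 1) ≤ θ ^ n := by
    rw [← hθN, ← pow_mul]
    refine pow_le_pow_of_le_one hθ0.le hθ1.le ?_
    have := Nat.div_add_mod n N
    have := Nat.mod_lt n hN
    rw [Nat.mul_add]; omega
  have h3 : ρ ^ (n / N) ≤ 2 * ρ ^ (n / N + 1) := by
    rw [pow_succ]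
    nlinarith [hρ.1, pow_pos hρ0 (n / N)]
  linarith

end Transfer

/-! ### Contraction of the truncated distance under the coupling -/

section Contraction

variable {X S : Type*} [Fintype S]

/-- The maps of the coupled system on `X × X`. -/
def pairMap (F : S → X → X) (i : S × S) (z : X × X) : X × X := (F i.1 z.1, F i.2 z.2)

/-- The weights of the coupled system on `X × X`. -/
def pairWeight (p : S → X → ℝ) (i : S × S) (z : X × X) : ℝ :=
  maximalCoupling (fun s => p s z.1) (fun s => p s z.2) i

variable {F : S → X → X} {p : S → X → ℝ} {β δ L K : ℝ}

theorem le_overlap [Nonempty S] (hδ : 0 < δ) (hp : ∀ s x, δ ≤ p s x) (x y : X) :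
    δ ≤ overlap (fun s => p s x) (fun s => p s y) := by
  obtain ⟨s₀⟩ := ‹Nonempty S›
  refine (le_min (hp s₀ x) (hp s₀ y)).trans ?_
  exact Finset.single_le_sum (f := fun s => min (p s x) (p s y))
    (fun s _ => hδ.le.trans (le_min (hp s x) (hp s y))) (Finset.mem_univ s₀)

/-- One step of the coupled system, when the test function is dominated by a constant along
synchronous moves. -/
theorem transfer_pair_le (hδ : 0 < δ) (hp : ∀ s x, δ ≤ p s x) (hp1 : ∀ x, ∑ s, p s x = 1)
    {h : X × X → ℝ} (h1 : ∀ z, h z ≤ 1) {z : X × X} {c : ℝ}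
    (hc : ∀ s, h (F s z.1, F s z.2) ≤ c) :
    transfer (pairWeight p) (pairMap F) h z
      ≤ overlap (fun s => p s z.1) (fun s => p s z.2) * c
        + (1 - overlap (fun s => p s z.1) (fun s => p s z.2)) := by
  refine (sum_maximalCoupling_mul_le (hp1 z.1) (hp1 z.2)
    (h := fun i => h (pairMap F i z)) fun i => h1 _).trans ?_
  rw [overlap, Finset.sum_mul]
  gcongr with s
  · exact hδ.le.trans (le_min (hp s _) (hp s _))
  · exact hc s

theorem pairWeight_nonneg (hδ : 0 < δ) (hp : ∀ s x, δ ≤ p s x) (hp1 : ∀ x, ∑ s, p s x = 1)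
    (i : S × S) (z : X × X) : 0 ≤ pairWeight p i z :=
  maximalCoupling_nonneg (fun s => hδ.le.trans (hp s _)) (fun s => hδ.le.trans (hp s _)) (hp1 _) i

variable [MetricSpace X]

/-- The truncated distance `min 1 (K d(x, y))`. -/
def truncDist (K : ℝ) (z : X × X) : ℝ := min 1 (K * dist z.1 z.2)

/-- The disagreement probability is a sum of positive parts of `p s x - p s y`, each controlled by
the Lipschitz bound. -/
theorem one_sub_overlap_le (hp1 : ∀ x, ∑ s, p s x = 1)
    (hL : ∀ s x y, |p s x - p s y| ≤ L * dist x y) (x y : X) :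
    1 - overlap (fun s => p s x) (fun s => p s y) ≤ Fintype.card S * L * dist x y := by
  rw [← sum_sub_min_left (hp1 x)]
  calc ∑ s, (p s x - min (p s x) (p s y)) ≤ ∑ _s : S, L * dist x y := by
        refine Finset.sum_le_sum fun s _ => ?_
        have h := hL s x y
        rcases min_cases (p s x) (p s y) with ⟨e, _⟩ | ⟨e, _⟩ <;> rw [e]
        · rw [sub_self]; exact (abs_nonneg _).trans h
        · exact (le_abs_self _).trans h
    _ = _ := by rw [Finset.sum_const, Finset.card_univ, nsmul_eq_mul, mul_assoc]

theorem truncDist_nonneg (hK : 0 ≤ K) (z : X × X) : 0 ≤ truncDist K z :=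
  le_min zero_le_one (mul_nonneg hK dist_nonneg)

theorem truncDist_le_one (K : ℝ) (z : X × X) : truncDist K z ≤ 1 := min_le_left _ _

/-- Agreement costs at most `β K d` and disagreement at most `card S * L * d`. The choice of `K`
bounds the latter by half of the gap `(1 - β) K d`, which leaves the factor `(1 + β) / 2`. -/
theorem transfer_pair_truncDist_le (hβ : β ∈ Set.Ioo (0 : ℝ) 1) (hδ : 0 < δ)
    (hp : ∀ s x, δ ≤ p s x) (hp1 : ∀ x, ∑ s, p s x = 1)
    (hL : ∀ s x y, |p s x - p s y| ≤ L * dist x y)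
    (hF : ∀ s x y, dist (F s x) (F s y) ≤ β * dist x y)
    (hK : 0 < K) (hKL : Fintype.card S * L ≤ K * ((1 - β) / 2)) {z : X × X}
    (hz : K * dist z.1 z.2 < 1) :
    transfer (pairWeight p) (pairMap F) (truncDist K) z ≤ (1 + β) / 2 * truncDist K z := by
  have hd : 0 ≤ dist z.1 z.2 := dist_nonneg
  refine (transfer_pair_le hδ hp hp1 (truncDist_le_one K) (c := K * (β * dist z.1 z.2))
    fun s => (min_le_right _ _).trans
      (mul_le_mul_of_nonneg_left (hF s z.1 z.2) hK.le)).trans ?_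
  have h1 := one_sub_overlap_le hp1 hL z.1 z.2
  have h2 : overlap (fun s => p s z.1) (fun s => p s z.2) ≤ 1 := overlap_le_one (hp1 z.1)
  have h3 : truncDist K z = K * dist z.1 z.2 := min_eq_right hz.le
  have h4 : Fintype.card S * L * dist z.1 z.2 ≤ K * ((1 - β) / 2) * dist z.1 z.2 :=
    mul_le_mul_of_nonneg_right hKL hd
  have h5 := mul_le_of_le_one_left (mul_nonneg hK.le (mul_nonneg hβ.1.le hd)) h2
  rw [h3]
  nlinarith

/-- With probability at least `δ ^ j` the first `j` moves all agree and shrink the distance by `β ^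
j`; on the remaining event the bound 1 is used. The outermost operator in the iterate is the first
move, so the induction varies `z`. -/
theorem transfer_pair_iterate_truncDist_le [Nonempty S] (hδ : 0 < δ)
    (hp : ∀ s x, δ ≤ p s x) (hp1 : ∀ x, ∑ s, p s x = 1)
    (hF : ∀ s x y, dist (F s x) (F s y) ≤ β * dist x y) (hβ : 0 < β)
    (hK : 0 < K)
    (hle : ∀ j z, (transfer (pairWeight p) (pairMap F))^[j] (truncDist K) z ≤ 1)
    (j : ℕ) (z : X × X) (hz : K * (β ^ j * dist z.1 z.2) ≤ 1) :
    (transfer (pairWeight p) (pairMap F))^[j] (truncDist K) z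
      ≤ 1 - δ ^ j * (1 - K * (β ^ j * dist z.1 z.2)) := by
  induction j generalizing z with
  | zero => simp [truncDist]
  | succ j ih =>
    have hb : 0 < β ^ j := pow_pos hβ j
    have key : ∀ s, K * (β ^ j * dist (F s z.1) (F s z.2))
        ≤ K * (β ^ (j + 1) * dist z.1 z.2) := fun s => by
      rw [pow_succ, mul_assoc (β ^ j)]
      gcongr
      exact hF s _ _
    rw [Function.iterate_succ_apply']
    refine (transfer_pair_le hδ hp hp1 (hle j)
      (c := 1 - δ ^ j * (1 - K * (β ^ (j + 1) * dist z.1 z.2))) fun s => ?_).trans ?_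
    · refine (ih _ ((key s).trans hz)).trans ?_
      have := key s
      gcongr
    · have h1 := le_overlap hδ hp z.1 z.2
      have h2 : 0 ≤ δ ^ j * (1 - K * (β ^ (j + 1) * dist z.1 z.2)) :=
        mul_nonneg (pow_nonneg hδ.le _) (sub_nonneg.2 hz)
      have h3 := mul_le_mul_of_nonneg_right h1 h2
      rw [pow_succ δ]
      nlinarith

/-- Geometric decay of the truncated distance under the coupled system. -/
theorem exists_transfer_pair_iterate_le [Nonempty S] (hβ : β ∈ Set.Ioo (0 : ℝ) 1) (hδ : 0 < δ)
    (hp : ∀ s x, δ ≤ p s x) (hp1 : ∀ x, ∑ s, p s x = 1)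
    (hL : ∀ s x y, |p s x - p s y| ≤ L * dist x y)
    (hF : ∀ s x y, dist (F s x) (F s y) ≤ β * dist x y) {D : ℝ} (hD : ∀ x y : X, dist x y ≤ D)
    (hK : 0 < K) (hKL : Fintype.card S * L ≤ K * ((1 - β) / 2)) :
    ∃ θ ∈ Set.Ioo (0 : ℝ) 1, ∀ n z,
      (transfer (pairWeight p) (pairMap F))^[n] (truncDist K) z ≤ 2 * θ ^ n := by
  rcases isEmpty_or_nonempty X with hX | ⟨⟨x₀⟩⟩
  · exact ⟨1 / 2, by norm_num, fun n z => hX.elim z.1⟩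
  have hw := pairWeight_nonneg (p := p) hδ hp hp1
  have hmono := transfer_mono (G := pairMap F) hw
  have hD0 : 0 ≤ D := dist_nonneg.trans (hD x₀ x₀)
  have hV : transfer (pairWeight p) (pairMap F) (truncDist K) ≤ truncDist K := fun z => by
    by_cases hz : K * dist z.1 z.2 < 1
    · refine (transfer_pair_truncDist_le hβ hδ hp hp1 hL hF hK hKL hz).trans ?_
      exact mul_le_of_le_one_left (truncDist_nonneg hK.le z) (by linarith [hβ.2])
    · rw [truncDist, min_eq_left (not_lt.1 hz)]
      refine (transfer_pair_le hδ hp hp1 (truncDist_le_one K) (c := 1)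
        fun s => truncDist_le_one K _).trans ?_
      linarith
  have hdecr : ∀ j, (transfer (pairWeight p) (pairMap F))^[j] (truncDist K) ≤ truncDist K :=
    fun j => by
      induction j with
      | zero => exact le_rfl
      | succ j ih =>
        rw [Function.iterate_succ_apply']
        exact (hmono ih).trans hV
  -- After `m + 1` agreements even a pair at distance `D` has `K d ≤ 1/2`. The `+ 1` in the
  -- denominator keeps it positive when `D = 0`.
  obtain ⟨m, hm⟩ := exists_pow_lt_of_lt_one (y := β) (x := 1 / (2 * (K * D + 1)))
    (by positivity) hβ.2
  have hKD : K * (β ^ (m + 1) * D) ≤ 1 / 2 := by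
    have h1 : β ^ (m + 1) ≤ 1 / (2 * (K * D + 1)) :=
      (pow_le_pow_of_le_one hβ.1.le hβ.2.le (Nat.le_succ m)).trans hm.le
    calc K * (β ^ (m + 1) * D) = K * D * β ^ (m + 1) := by ring
      _ ≤ K * D * (1 / (2 * (K * D + 1))) := by gcongr
      _ ≤ 1 / 2 := by
        rw [mul_one_div, div_le_div_iff₀ (by positivity) (by norm_num)]
        linarith
  refine transfer_iterate_le_of_contraction hw (truncDist_le_one K) hV (Nat.succ_pos m)
    -- The three entries serve the requirement `1/2 ≤ ρ`, close pairs and distant pairs, in this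
    -- order.
    (ρ := max (1 / 2) (max ((1 + β) / 2) (1 - δ ^ (m + 1) * (1 / 2))))
    ⟨le_max_left _ _, max_lt (by norm_num) (max_lt (by linarith [hβ.2]) ?_)⟩ fun z => ?_
  · have := pow_pos hδ (m + 1)
    linarith
  · have hV0 := truncDist_nonneg hK.le z
    simp only [Pi.smul_apply, smul_eq_mul]
    by_cases hz : K * dist z.1 z.2 < 1
    · rw [Function.iterate_succ_apply']
      refine (hmono (hdecr m) z).trans
        ((transfer_pair_truncDist_le hβ hδ hp hp1 hL hF hK hKL hz).trans ?_)
      exact mul_le_mul_of_nonneg_right ((le_max_left _ _).trans (le_max_right _ _)) hV0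
    · have hd : K * (β ^ (m + 1) * dist z.1 z.2) ≤ 1 / 2 := by
        refine le_trans ?_ hKD
        have := hD z.1 z.2
        have := hβ.1
        gcongr
      have := transfer_pair_iterate_truncDist_le hδ hp hp1 hF hβ.1 hK
        (fun j z => (hdecr j z).trans (truncDist_le_one K z)) (m + 1) z (by linarith)
      refine this.trans ?_
      rw [truncDist, min_eq_left (not_lt.1 hz), mul_one]
      refine le_trans ?_ ((le_max_right _ _).trans (le_max_right _ _))
      have := pow_pos hδ (m + 1)
      gcongr
      linarith

end Contraction

open Filter Topology
open scoped NNReal BoundedContinuousFunction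

/-! ### Kernels with finitely many moves -/

section FiniteKernel

variable {Y I : Type*} [Fintype I] [MeasurableSpace Y]

/-- The kernel that moves from `y` to `G i y` with probability `w i y`. -/
def finiteKernel (w : I → Y → ℝ) (G : I → Y → Y) (hw : ∀ i, Measurable (w i))
    (hG : ∀ i, Measurable (G i)) : Kernel Y Y where
  toFun y := ∑ i, ENNReal.ofReal (w i y) • Measure.dirac (G i y)
  measurable' := by
    refine Measure.measurable_of_measurable_coe _ fun t ht => ?_
    simp only [Measure.coe_finsetSum, Finset.sum_apply, Measure.smul_apply, smul_eq_mul]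
    refine Finset.measurable_fun_sum _ fun i _ => ?_
    exact (hw i).ennreal_ofReal.mul
      ((Measure.measurable_coe ht).comp (Measure.measurable_dirac.comp (hG i)))

variable {w : I → Y → ℝ} {G : I → Y → Y} {hw : ∀ i, Measurable (w i)}
  {hG : ∀ i, Measurable (G i)}

theorem lintegral_finiteKernel {f : Y → ℝ≥0∞} (hf : Measurable f) (y : Y) :
    ∫⁻ x, f x ∂(finiteKernel w G hw hG y) = ∑ i, ENNReal.ofReal (w i y) * f (G i y) := by
  change ∫⁻ x, f x ∂(∑ i, ENNReal.ofReal (w i y) • Measure.dirac (G i y)) = _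
  rw [lintegral_finsetSum_measure]
  simp only [lintegral_smul_measure, lintegral_dirac' _ hf, smul_eq_mul]

theorem isMarkovKernel_finiteKernel (hw0 : ∀ i y, 0 ≤ w i y) (hw1 : ∀ y, ∑ i, w i y = 1) :
    IsMarkovKernel (finiteKernel w G hw hG) := by
  refine ⟨fun y => ⟨?_⟩⟩
  rw [← lintegral_one, lintegral_finiteKernel measurable_const]
  simp only [mul_one]
  rw [← ENNReal.ofReal_sum_of_nonneg fun i _ => hw0 i y, hw1, ENNReal.ofReal_one]

/-- Translates the real-valued decay of transfer iterates into expectations under the chain; the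
induction conditions on the first move. -/
theorem lintegral_finiteKernel_pow (hw0 : ∀ i y, 0 ≤ w i y) {f : Y → ℝ} (hf : Measurable f)
    (hf0 : ∀ y, 0 ≤ f y) (n : ℕ) (y : Y) :
    ∫⁻ x, ENNReal.ofReal (f x) ∂((finiteKernel w G hw hG ^ n) y)
      = ENNReal.ofReal ((transfer w G)^[n] f y) := by
  induction n generalizing y with
  | zero => exact lintegral_dirac' _ hf.ennreal_ofReal
  | succ n ih =>
    have hm : Measurable fun b => ∫⁻ x, ENNReal.ofReal (f x) ∂((finiteKernel w G hw hG ^ n) b) :=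
      hf.ennreal_ofReal.lintegral_kernel
    rw [pow_succ]
    change ∫⁻ x, _ ∂(((finiteKernel w G hw hG ^ n) ∘ₖ finiteKernel w G hw hG) y) = _
    rw [Kernel.lintegral_comp _ _ _ hf.ennreal_ofReal, lintegral_finiteKernel hm]
    simp only [ih]
    rw [Function.iterate_succ_apply', transfer, ENNReal.ofReal_sum_of_nonneg]
    · exact Finset.sum_congr rfl fun i _ => (ENNReal.ofReal_mul (hw0 i y)).symm
    · exact fun i _ => mul_nonneg (hw0 i y) (transfer_iterate_nonneg hw0 hf0 n _)

end FiniteKernel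

/-! ### Iterated laws and their marginals -/

section Marginals

variable {X Y : Type*} [MeasurableSpace X] [MeasurableSpace Y]

theorem bind_kernel_pow_succ (P : Kernel X X) (ν : Measure X) (n : ℕ) :
    ν.bind ⇑(P ^ (n + 1)) = (ν.bind ⇑(P ^ n)).bind P := by
  rw [pow_succ']
  exact Measure.comp_assoc.symm

theorem bind_kernel_pow_succ' (P : Kernel X X) (ν : Measure X) (n : ℕ) :
    ν.bind ⇑(P ^ (n + 1)) = (ν.bind P).bind ⇑(P ^ n) := by
  rw [pow_succ]
  exact Measure.comp_assoc.symm

theorem bind_kernel_pow_zero (P : Kernel X X) (ν : Measure X) : ν.bind ⇑(P ^ 0) = ν :=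
  Measure.bind_dirac

theorem isProbabilityMeasure_bind_pow (P : Kernel X X) [IsMarkovKernel P] (ν : Measure X)
    [IsProbabilityMeasure ν] (n : ℕ) : IsProbabilityMeasure (ν.bind ⇑(P ^ n)) := by
  induction n with
  | zero => rwa [bind_kernel_pow_zero]
  | succ n ih => rw [bind_kernel_pow_succ]; infer_instance

theorem invariant_bind_pow {P : Kernel X X} {μ : Measure X} (hμ : P.Invariant μ) (n : ℕ) :
    μ.bind ⇑(P ^ n) = μ := by
  induction n with
  | zero => exact bind_kernel_pow_zero P μ
  | succ n ih => rw [bind_kernel_pow_succ, ih]; exact hμ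

/-- A semiconjugacy between two kernels passes to the laws of the chains. -/
theorem map_bind_kernel_pow {Q : Kernel Y Y} {P : Kernel X X} {g : Y → X} (hg : Measurable g)
    (h : ∀ y, (Q y).map g = P (g y)) (π : Measure Y) (n : ℕ) :
    (π.bind ⇑(Q ^ n)).map g = (π.map g).bind ⇑(P ^ n) := by
  have step : ∀ π : Measure Y, (π.bind Q).map g = (π.map g).bind P := fun π => by
    ext t ht
    rw [Measure.map_apply hg ht, Measure.bind_apply (hg ht) Q.measurable.aemeasurable,
      Measure.bind_apply ht P.measurable.aemeasurable, lintegral_map (P.measurable_coe ht) hg]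
    exact lintegral_congr fun y => by rw [← h y, Measure.map_apply hg ht]
  induction n with
  | zero => simp only [bind_kernel_pow_zero]
  | succ n ih => rw [bind_kernel_pow_succ, step, ih, bind_kernel_pow_succ]

theorem measurable_pairWeight {X S : Type*} [MeasurableSpace X] [Fintype S] {p : S → X → ℝ}
    (hp : ∀ s, Measurable (p s)) (i : S × S) :
    Measurable (pairWeight p i) := by
  have h1 : ∀ s, Measurable fun z : X × X => p s z.1 := fun s => (hp s).comp measurable_fst
  have h2 : ∀ s, Measurable fun z : X × X => p s z.2 := fun s => (hp s).comp measurable_snd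
  unfold pairWeight maximalCoupling overlap
  refine Measurable.add ?_ (Measurable.div ?_ ?_)
  · by_cases h : i.1 = i.2
    · simpa only [h, if_true] using (h1 i.2).min (h2 i.2)
    · simp only [h, if_false]; exact measurable_const
  · exact ((h1 _).sub ((h1 _).min (h2 _))).mul ((h2 _).sub ((h1 _).min (h2 _)))
  · exact measurable_const.sub (Finset.measurable_fun_sum _ fun s _ => (h1 s).min (h2 s))

theorem measurable_pairMap {X S : Type*} [MeasurableSpace X] {F : S → X → X}
    (hF : ∀ s, Measurable (F s)) (i : S × S) :
    Measurable (pairMap F i) :=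
  ((hF _).comp measurable_fst).prodMk ((hF _).comp measurable_snd)

end Marginals

/-! ### Geometric mixing of contracting iterated function systems -/

/-- `P` mixes geometrically with constant `C` and rate `θ`: the laws at time `n` from any two
initial laws have a coupling with mean distance at most `C θ ^ n`. -/
def MixesGeometrically {X : Type*} [MetricSpace X] [MeasurableSpace X] (P : Kernel X X)
    (C θ : ℝ) : Prop :=
  ∀ (ν ν' : Measure X) [IsProbabilityMeasure ν] [IsProbabilityMeasure ν'] (n : ℕ),
    ∃ π : Measure (X × X), π.map Prod.fst = ν.bind ⇑(P ^ n) ∧ π.map Prod.snd = ν'.bind ⇑(P ^ n) ∧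
      ∫⁻ z, edist z.1 z.2 ∂π ≤ ENNReal.ofReal (C * θ ^ n)

section IteratedFunctionSystem

variable {X S : Type*} [MetricSpace X] [CompactSpace X] [MeasurableSpace X] [BorelSpace X]
  [Fintype S] {F : S → X → X} {p : S → X → ℝ} {β δ L : ℝ}

/-- A contracting iterated function system with Lipschitz probabilities that are bounded away from
zero mixes geometrically. -/
theorem exists_mixesGeometrically [Nonempty S] (hβ : β ∈ Set.Ioo (0 : ℝ) 1) (hδ : 0 < δ)
    (hp : ∀ s x, δ ≤ p s x) (hp1 : ∀ x, ∑ s, p s x = 1)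
    (hL : ∀ s x y, |p s x - p s y| ≤ L * dist x y)
    (hF : ∀ s x y, dist (F s x) (F s y) ≤ β * dist x y) {D : ℝ} (hD0 : 0 < D)
    (hD : ∀ x y : X, dist x y ≤ D) (hpm : ∀ s, Measurable (p s)) (hFm : ∀ s, Measurable (F s)) :
    ∃ θ ∈ Set.Ioo (0 : ℝ) 1, MixesGeometrically (finiteKernel p F hpm hFm) (2 * D) θ := by
  have hβ' : 0 < (1 - β) / 2 := by linarith [hβ.2]
  -- `K` must be large twice: `K ≥ D⁻¹` gives `d ≤ D * truncDist K`, and the second bound is the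
  -- condition for contraction of close pairs.
  obtain ⟨K, hKD, hKL⟩ : ∃ K, D⁻¹ ≤ K ∧ Fintype.card S * L ≤ K * ((1 - β) / 2) :=
    ⟨max D⁻¹ (Fintype.card S * L / ((1 - β) / 2)), le_max_left _ _,
      (div_le_iff₀ hβ').1 (le_max_right _ _)⟩
  have hK : 0 < K := (inv_pos.2 hD0).trans_le hKD
  obtain ⟨θ, hθ, hT⟩ := exists_transfer_pair_iterate_le hβ hδ hp hp1 hL hF hD hK hKL
  have hw0 := pairWeight_nonneg (p := p) hδ hp hp1
  have hVm : Measurable (truncDist K : X × X → ℝ) :=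
    (continuous_const.min (continuous_const.mul continuous_dist)).measurable
  refine ⟨θ, hθ, fun ν ν' _ _ n => ?_⟩
  set Q := finiteKernel (pairWeight p) (pairMap F) (measurable_pairWeight hpm)
    (measurable_pairMap hFm) with hQ
  have hfst : ∀ z, (Q z).map Prod.fst = finiteKernel p F hpm hFm z.1 := fun z => by
    refine Measure.ext_of_lintegral _ fun f hf => ?_
    rw [lintegral_map hf measurable_fst, hQ,
      lintegral_finiteKernel (f := fun z : X × X => f z.1) (hf.comp measurable_fst),
      lintegral_finiteKernel hf, Fintype.sum_prod_type]
    refine Finset.sum_congr rfl fun s _ => ?_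
    simp only [pairMap, ← Finset.sum_mul]
    rw [← ENNReal.ofReal_sum_of_nonneg fun t _ => hw0 _ _]
    exact congrArg (fun r => ENNReal.ofReal r * _) (sum_maximalCoupling_snd (hp1 _) (hp1 _) s)
  have hsnd : ∀ z, (Q z).map Prod.snd = finiteKernel p F hpm hFm z.2 := fun z => by
    refine Measure.ext_of_lintegral _ fun f hf => ?_
    rw [lintegral_map hf measurable_snd, hQ,
      lintegral_finiteKernel (f := fun z : X × X => f z.2) (hf.comp measurable_snd),
      lintegral_finiteKernel hf, Fintype.sum_prod_type_right]
    refine Finset.sum_congr rfl fun s _ => ?_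
    simp only [pairMap, ← Finset.sum_mul]
    rw [← ENNReal.ofReal_sum_of_nonneg fun t _ => hw0 _ _]
    exact congrArg (fun r => ENNReal.ofReal r * _) (sum_maximalCoupling_fst (hp1 _) (hp1 _) s)
  -- Any initial coupling works since the decay is uniform in the starting pair; the independent one
  -- is at hand.
  refine ⟨(ν.prod ν').bind ⇑(Q ^ n), ?_, ?_, ?_⟩
  · rw [map_bind_kernel_pow measurable_fst hfst, Measure.map_fst_prod, measure_univ, one_smul]
  · rw [map_bind_kernel_pow measurable_snd hsnd, Measure.map_snd_prod, measure_univ, one_smul]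
  · have hle : ∀ z : X × X, edist z.1 z.2 ≤ ENNReal.ofReal D * ENNReal.ofReal (truncDist K z) := by
      intro z
      rw [← ENNReal.ofReal_mul hD0.le, edist_dist]
      refine ENNReal.ofReal_le_ofReal ?_
      rw [truncDist, mul_min_of_nonneg _ _ hD0.le, mul_one]
      refine le_min (hD _ _) ?_
      rw [← mul_assoc]
      refine le_mul_of_one_le_left dist_nonneg ?_
      calc (1 : ℝ) = D * D⁻¹ := (mul_inv_cancel₀ hD0.ne').symm
        _ ≤ D * K := by gcongr
    calc ∫⁻ z, edist z.1 z.2 ∂((ν.prod ν').bind ⇑(Q ^ n))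
        ≤ ∫⁻ z, ENNReal.ofReal D * ENNReal.ofReal (truncDist K z) ∂((ν.prod ν').bind ⇑(Q ^ n)) :=
          lintegral_mono hle
      _ = ENNReal.ofReal D * ∫⁻ y, ENNReal.ofReal
            ((transfer (pairWeight p) (pairMap F))^[n] (truncDist K) y) ∂(ν.prod ν') := by
          rw [lintegral_const_mul _ hVm.ennreal_ofReal,
            Measure.lintegral_bind (Q ^ n).measurable.aemeasurable hVm.ennreal_ofReal.aemeasurable]
          simp only [hQ, lintegral_finiteKernel_pow hw0 hVm (truncDist_nonneg hK.le)]
      _ ≤ ENNReal.ofReal D * ∫⁻ _, ENNReal.ofReal (2 * θ ^ n) ∂(ν.prod ν') := by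
          gcongr with y
          exact hT n y
      _ = ENNReal.ofReal (2 * D * θ ^ n) := by
          rw [lintegral_const, measure_univ, mul_one, ← ENNReal.ofReal_mul hD0.le]
          congr 1; ring

/-- The kernel of an iterated function system with continuous maps and weights is Feller. -/
theorem exists_boundedContinuous_lintegral_finiteKernel (hp : ∀ s, Continuous (p s))
    (hF : ∀ s, Continuous (F s)) (hpm : ∀ s, Measurable (p s)) (hFm : ∀ s, Measurable (F s))
    (f : X →ᵇ ℝ≥0) :
    ∃ g : X →ᵇ ℝ≥0, ∀ x, ∫⁻ y, f y ∂(finiteKernel p F hpm hFm x) = g x := by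
  have hc : Continuous fun x => ∑ s, Real.toNNReal (p s x) * f (F s x) := by
    refine continuous_finsetSum _ fun s _ => ?_
    exact (continuous_real_toNNReal.comp (hp s)).mul (f.continuous.comp (hF s))
  refine ⟨BoundedContinuousFunction.mkOfCompact ⟨_, hc⟩, fun x => ?_⟩
  rw [lintegral_finiteKernel (by exact (ENNReal.continuous_coe.comp f.continuous).measurable)]
  simp only [BoundedContinuousFunction.mkOfCompact_apply, ContinuousMap.coe_mk,
    ENNReal.ofNNReal_finsetSum, ENNReal.coe_mul]
  rfl

end IteratedFunctionSystem

/-! ### Invariant laws and Wasserstein bounds from mixing -/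

section Ergodic

variable {X : Type*} [MetricSpace X] [CompactSpace X]

/-- On a compact space a continuous function has an affine modulus of continuity with arbitrarily
small constant term. -/
theorem exists_le_add_mul_dist (f : X →ᵇ ℝ≥0) {η : ℝ≥0} (hη : 0 < η) :
    ∃ A : ℝ≥0, ∀ x y, (f x : ℝ≥0∞) ≤ f y + (η + A * edist x y) := by
  obtain ⟨r, hr, hfr⟩ := Metric.uniformContinuous_iff.1
    (CompactSpace.uniformContinuous_of_continuous f.continuous) η hη
  lift r to ℝ≥0 using le_of_lt hr
  have hr' : r ≠ 0 := by rintro rfl; exact lt_irrefl _ hr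
  -- Below distance `r` uniform continuity suffices; beyond it the slope makes the linear term
  -- exceed the supremum of `f`.
  refine ⟨nndist f 0 / r, fun x y => ?_⟩
  rw [edist_nndist]
  norm_cast
  by_cases h : dist x y < r
  · have := hfr h
    rw [NNReal.dist_eq] at this
    have h2 : (f x : ℝ) ≤ f y + η := by linarith [(abs_lt.1 this).2]
    exact (NNReal.coe_le_coe.1 (by exact_mod_cast h2)).trans
      (by rw [← add_assoc]; exact le_self_add)
  · have h1 : f x ≤ nndist f 0 := by
      have := f.dist_coe_le_dist (g := 0) x
      have h0 : dist (f x) ((0 : X →ᵇ ℝ≥0) x) = f x := by simp [NNReal.dist_eq]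
      rw [h0] at this
      exact_mod_cast this
    have h2 : r ≤ nndist x y := by
      rw [← NNReal.coe_le_coe, coe_nndist]; exact not_lt.1 h
    calc f x ≤ nndist f 0 := h1
      _ = nndist f 0 / r * r := (div_mul_cancel₀ _ hr').symm
      _ ≤ nndist f 0 / r * nndist x y := by gcongr
      _ ≤ _ := by rw [← add_assoc]; exact le_add_self

variable [MeasurableSpace X] [BorelSpace X]

/-- Under geometric mixing, integrals of continuous functions forget the initial law. -/
theorem MixesGeometrically.eventually_lintegral_le {P : Kernel X X} [IsMarkovKernel P] {C θ : ℝ}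
    (hθ : θ ∈ Set.Ioo (0 : ℝ) 1) (hP : MixesGeometrically P C θ) (ν ν' : Measure X)
    [IsProbabilityMeasure ν] [IsProbabilityMeasure ν'] (f : X →ᵇ ℝ≥0) {η : ℝ≥0} (hη : 0 < η) :
    ∀ᶠ n in atTop, ∫⁻ x, f x ∂(ν.bind ⇑(P ^ n)) ≤ ∫⁻ x, f x ∂(ν'.bind ⇑(P ^ n)) + η := by
  have hη2 : 0 < η / 2 := half_pos hη
  obtain ⟨A, hA⟩ := exists_le_add_mul_dist f hη2
  have hfm : Measurable fun x => (f x : ℝ≥0∞) :=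
    (ENNReal.continuous_coe.comp f.continuous).measurable
  have hlim : Tendsto (fun n : ℕ => (A : ℝ≥0∞) * ENNReal.ofReal (C * θ ^ n)) atTop (𝓝 0) := by
    have h := (tendsto_pow_atTop_nhds_zero_of_lt_one hθ.1.le hθ.2).const_mul C
    have h2 := ENNReal.Tendsto.const_mul (a := (A : ℝ≥0∞))
      (ENNReal.tendsto_ofReal h) (Or.inr ENNReal.coe_ne_top)
    simpa using h2
  have hev : ∀ᶠ n : ℕ in atTop, (A : ℝ≥0∞) * ENNReal.ofReal (C * θ ^ n) < (η / 2 : ℝ≥0) :=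
    hlim.eventually_lt_const (by exact_mod_cast hη2)
  filter_upwards [hev] with n hn
  obtain ⟨π, h1, h2, h3⟩ := hP ν ν' n
  have hprob := isProbabilityMeasure_bind_pow P ν n
  have hπ : π Set.univ = 1 := by
    have : (π.map Prod.fst) Set.univ = 1 := by rw [h1]; exact measure_univ
    rwa [Measure.map_apply measurable_fst MeasurableSet.univ, Set.preimage_univ] at this
  have hed : Measurable fun z : X × X => edist z.1 z.2 := measurable_edist
  rw [← h1, ← h2, lintegral_map hfm measurable_fst, lintegral_map hfm measurable_snd]
  calc ∫⁻ z, f z.1 ∂π ≤ ∫⁻ z, (f z.2 + ((η / 2 : ℝ≥0) + A * edist z.1 z.2)) ∂π :=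
        lintegral_mono fun z => hA z.1 z.2
    _ = ∫⁻ z, f z.2 ∂π + ((η / 2 : ℝ≥0) + A * ∫⁻ z, edist z.1 z.2 ∂π) := by
        rw [lintegral_add_left (f := fun z : X × X => (f z.2 : ℝ≥0∞)) (hfm.comp measurable_snd),
          lintegral_add_left measurable_const,
          lintegral_const, hπ, mul_one, lintegral_const_mul _ hed]
    _ ≤ ∫⁻ z, f z.2 ∂π + ((η / 2 : ℝ≥0) + (η / 2 : ℝ≥0)) := by
        gcongr
        exact (mul_le_mul_right h3 _).trans hn.le
    _ = _ := by norm_cast; rw [add_halves]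

/-- Invariant laws do not move with `n`, so merging forces equal integrals of continuous functions,
and these determine a finite measure. -/
theorem MixesGeometrically.invariant_unique {P : Kernel X X} [IsMarkovKernel P] {C θ : ℝ}
    (hθ : θ ∈ Set.Ioo (0 : ℝ) 1) (hP : MixesGeometrically P C θ) {μ μ' : Measure X}
    [IsProbabilityMeasure μ] [IsProbabilityMeasure μ'] (hμ : P.Invariant μ)
    (hμ' : P.Invariant μ') : μ' = μ := by
  have key : ∀ (ν ν' : Measure X) [IsProbabilityMeasure ν] [IsProbabilityMeasure ν'],
      P.Invariant ν → P.Invariant ν' → ∀ f : X →ᵇ ℝ≥0,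
        ∫⁻ x, f x ∂ν ≤ ∫⁻ x, f x ∂ν' := fun ν ν' _ _ h h' f => by
    refine ENNReal.le_of_forall_pos_le_add fun η hη _ => ?_
    obtain ⟨n, hn⟩ := (hP.eventually_lintegral_le hθ ν ν' f hη).exists
    rwa [invariant_bind_pow h, invariant_bind_pow h'] at hn
  exact ext_of_forall_lintegral_eq_of_IsFiniteMeasure fun f =>
    le_antisymm (key μ' μ hμ' hμ f) (key μ μ' hμ hμ' f)

/-- A geometrically mixing Feller kernel on a compact space has an invariant law. -/
theorem MixesGeometrically.exists_invariant [Nonempty X] {P : Kernel X X} [IsMarkovKernel P]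
    {C θ : ℝ} (hθ : θ ∈ Set.Ioo (0 : ℝ) 1) (hP : MixesGeometrically P C θ)
    (hFeller : ∀ f : X →ᵇ ℝ≥0, ∃ g : X →ᵇ ℝ≥0, ∀ x, ∫⁻ y, f y ∂(P x) = g x) :
    ∃ μ : Measure X, IsProbabilityMeasure μ ∧ P.Invariant μ := by
  obtain ⟨x₀⟩ := ‹Nonempty X›
  let ν : Measure X := Measure.dirac x₀
  let law : ℕ → ProbabilityMeasure X := fun n =>
    ⟨ν.bind ⇑(P ^ n), isProbabilityMeasure_bind_pow P ν n⟩
  -- The candidate is a limit of the laws along an ultrafilter, which exists by compactness of the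
  -- space of probability measures.
  let U : Ultrafilter ℕ := Ultrafilter.of atTop
  have hU : (U : Filter ℕ) ≤ atTop := Ultrafilter.of_le atTop
  obtain ⟨μ, -, hμ⟩ := isCompact_univ.ultrafilter_le_nhds (U.map law) (by simp)
  have hlim : Tendsto law U (𝓝 μ) := hμ
  rw [ProbabilityMeasure.tendsto_iff_forall_lintegral_tendsto] at hlim
  refine ⟨μ, inferInstance, ?_⟩
  refine ext_of_forall_lintegral_eq_of_IsFiniteMeasure fun f => ?_
  obtain ⟨g, hg⟩ := hFeller f
  have hfm : Measurable fun x => (f x : ℝ≥0∞) :=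
    (ENNReal.continuous_coe.comp f.continuous).measurable
  have hbind : ∀ ρ : Measure X, ∫⁻ x, f x ∂(ρ.bind P) = ∫⁻ x, g x ∂ρ := fun ρ => by
    rw [Measure.lintegral_bind P.measurable.aemeasurable hfm.aemeasurable]
    exact lintegral_congr hg
  -- One more step after time `n` amounts to starting from `ν.bind P`; mixing then makes the shifted
  -- and unshifted limits agree.
  have hstep : ∀ n, ∫⁻ x, g x ∂(law n : Measure X) = ∫⁻ x, f x ∂((ν.bind P).bind ⇑(P ^ n)) :=
    fun n => by
      rw [← hbind, ← bind_kernel_pow_succ', bind_kernel_pow_succ]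
      rfl
  rw [hbind]
  refine le_antisymm ?_ ?_
  · refine ENNReal.le_of_forall_pos_le_add fun η hη _ => ?_
    refine le_of_tendsto_of_tendsto (hlim g) ((hlim f).add tendsto_const_nhds) ?_
    filter_upwards [hU (hP.eventually_lintegral_le hθ (ν.bind P) ν f hη)] with n hn
    rw [hstep]
    exact hn
  · refine ENNReal.le_of_forall_pos_le_add fun η hη _ => ?_
    refine le_of_tendsto_of_tendsto (hlim f) ((hlim g).add tendsto_const_nhds) ?_
    filter_upwards [hU (hP.eventually_lintegral_le hθ ν (ν.bind P) f hη)] with n hn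
    simp only [hstep]
    exact hn

theorem MixesGeometrically.wasserstein_rpow_le {P : Kernel X X} {C θ : ℝ}
    (hP : MixesGeometrically P C θ) {D : ℝ} (hD0 : 0 < D) (hD : ∀ x y : X, dist x y ≤ D)
    {μ : Measure X} [IsProbabilityMeasure μ] (hμ : P.Invariant μ) {α : ℝ} (hα : 1 ≤ α)
    (ν : Measure X) [IsProbabilityMeasure ν] (n : ℕ) :
    wasserstein α (ν.bind ⇑(P ^ n)) μ ^ α ≤ ENNReal.ofReal (D ^ (α - 1) * (C * θ ^ n)) := by
  have hα0 : 0 < α := zero_lt_one.trans_le hα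
  obtain ⟨π, h1, h2, h3⟩ := hP ν μ n
  rw [invariant_bind_pow hμ] at h2
  rw [wasserstein, ← ENNReal.rpow_mul, one_div, inv_mul_cancel₀ hα0.ne', ENNReal.rpow_one]
  have hle : ∀ z : X × X,
      edist z.1 z.2 ^ α ≤ ENNReal.ofReal (D ^ (α - 1)) * edist z.1 z.2 := fun z => by
    calc edist z.1 z.2 ^ α = edist z.1 z.2 ^ ((α - 1) + 1) := by rw [sub_add_cancel]
      _ = edist z.1 z.2 ^ (α - 1) * edist z.1 z.2 := by
        rw [ENNReal.rpow_add_of_nonneg _ _ (sub_nonneg.2 hα) zero_le_one, ENNReal.rpow_one]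
      _ ≤ _ := by
        rw [← ENNReal.ofReal_rpow_of_pos hD0]
        gcongr ?_ * _
        refine ENNReal.rpow_le_rpow ?_ (sub_nonneg.2 hα)
        rw [edist_dist]; exact ENNReal.ofReal_le_ofReal (hD _ _)
  calc _ ≤ ∫⁻ z, edist z.1 z.2 ^ α ∂π := iInf₂_le π ⟨h1, h2⟩
    _ ≤ ∫⁻ z, ENNReal.ofReal (D ^ (α - 1)) * edist z.1 z.2 ∂π := lintegral_mono hle
    _ = ENNReal.ofReal (D ^ (α - 1)) * ∫⁻ z, edist z.1 z.2 ∂π :=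
        lintegral_const_mul _ measurable_edist
    _ ≤ ENNReal.ofReal (D ^ (α - 1)) * ENNReal.ofReal (C * θ ^ n) := by gcongr
    _ = _ := (ENNReal.ofReal_mul (Real.rpow_nonneg hD0.le _)).symm

end Ergodic

/-! ### Bounds on the play probabilities -/

section BestReply

variable {A B : Type*} [Fintype A] [Fintype B]

theorem bestReplies_nonempty [Nonempty A] (u : A → B → ℝ) (σ : B → ℝ) :
    (bestReplies u σ).Nonempty := by
  obtain ⟨a, ha⟩ := Finite.exists_max (expectedPayoff u σ)
  exact ⟨a, by simp [bestReplies, ha]⟩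

theorem bestReplyProb_nonneg (u : A → B → ℝ) (σ : B → ℝ) (a : A) : 0 ≤ bestReplyProb u σ a := by
  unfold bestReplyProb
  split_ifs <;> positivity

theorem sum_bestReplyProb [Nonempty A] (u : A → B → ℝ) (σ : B → ℝ) :
    ∑ a, bestReplyProb u σ a = 1 := by
  classical
  have h : ((bestReplies u σ).card : ℝ) ≠ 0 :=
    Nat.cast_ne_zero.2 (Finset.card_ne_zero.2 (bestReplies_nonempty u σ))
  simp only [bestReplyProb]
  rw [Finset.sum_ite_mem, Finset.univ_inter, Finset.sum_const, nsmul_eq_mul, mul_one_div_cancel h]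

variable {u : A → B → ℝ} {k : ℕ} {ε : ℝ} {p : B → ℝ}

theorem sum_playProb [Nonempty A] (hp : p ∈ stdSimplex ℝ B) : ∑ a, playProb u k ε p a = 1 := by
  have hA : (Fintype.card A : ℝ) ≠ 0 := Nat.cast_ne_zero.2 Fintype.card_ne_zero
  have hω : ∑ ω : Fin k → B, ∏ j, p (ω j) = 1 := by
    rw [← Fintype.prod_sum fun (_ : Fin k) b => p b]
    simp [hp.2]
  simp only [playProb, Finset.sum_add_distrib, ← Finset.mul_sum]
  rw [Finset.sum_comm]
  simp only [← Finset.mul_sum, sum_bestReplyProb, mul_one]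
  rw [hω, Finset.sum_const, Finset.card_univ, nsmul_eq_mul, mul_div_cancel₀ _ hA]
  ring

theorem le_playProb (hp : p ∈ stdSimplex ℝ B) (hε : ε ≤ 1) (a : A) :
    ε / Fintype.card A ≤ playProb u k ε p a := by
  refine le_add_of_nonneg_left (mul_nonneg (sub_nonneg.2 hε) ?_)
  exact Finset.sum_nonneg fun ω _ =>
    mul_nonneg (Finset.prod_nonneg fun j _ => hp.1 _) (bestReplyProb_nonneg _ _ _)

end BestReply

/-! ### The Recency Weighted Sampler as a contracting system -/

section Chain

variable {S₁ S₂ : Type*} [Fintype S₁] [Fintype S₂]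

theorem isCompact_square : IsCompact {x : EuclideanSpace ℝ (S₁ ⊕ S₂) |
    (fun s => x (Sum.inl s)) ∈ stdSimplex ℝ S₁ ∧ (fun s => x (Sum.inr s)) ∈ stdSimplex ℝ S₂} := by
  have h := ((isCompact_stdSimplex ℝ S₁).prod (isCompact_stdSimplex ℝ S₂)).image
    (f := fun q : (S₁ → ℝ) × (S₂ → ℝ) =>
      (WithLp.toLp 2 (Sum.elim q.1 q.2) : EuclideanSpace ℝ (S₁ ⊕ S₂))) (by
        refine (PiLp.continuous_toLp 2 _).comp (continuous_pi ?_)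
        rintro (s | s) <;> simp only [Sum.elim_inl, Sum.elim_inr] <;> fun_prop)
  convert h using 1
  ext x
  constructor
  · rintro ⟨h1, h2⟩
    refine ⟨(fun s => x (Sum.inl s), fun s => x (Sum.inr s)), ⟨h1, h2⟩, ?_⟩
    ext (s | s) <;> rfl
  · rintro ⟨q, ⟨h1, h2⟩, rfl⟩
    exact ⟨h1, h2⟩

instance compactSpace_square : CompactSpace (Square S₁ S₂) :=
  isCompact_iff_compactSpace.1 isCompact_square

instance nonempty_square [Nonempty S₁] [Nonempty S₂] : Nonempty (Square S₁ S₂) := by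
  classical
  obtain ⟨s₁⟩ := ‹Nonempty S₁›
  obtain ⟨s₂⟩ := ‹Nonempty S₂›
  exact ⟨⟨WithLp.toLp 2 (Sum.elim (Pi.single s₁ 1) (Pi.single s₂ 1)),
    single_mem_stdSimplex ℝ s₁, single_mem_stdSimplex ℝ s₂⟩⟩

/-- The triangle inequality through the origin. The absolute value and the `+ 1` make the bound
positive for every real value of the radius. -/
theorem dist_square_le (x y : Square S₁ S₂) :
    dist x y ≤ 2 * |⨆ z : Square S₁ S₂, ‖(z : EuclideanSpace ℝ (S₁ ⊕ S₂))‖| + 1 := by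
  have hb : BddAbove (Set.range fun z : Square S₁ S₂ => ‖(z : EuclideanSpace ℝ (S₁ ⊕ S₂))‖) :=
    (isCompact_range (by fun_prop)).bddAbove
  have hx := le_ciSup hb x
  have hy := le_ciSup hb y
  have h1 := le_abs_self (⨆ z : Square S₁ S₂, ‖(z : EuclideanSpace ℝ (S₁ ⊕ S₂))‖)
  have h2 : dist x y ≤ ‖(x : EuclideanSpace ℝ (S₁ ⊕ S₂))‖
      + ‖(y : EuclideanSpace ℝ (S₁ ⊕ S₂))‖ := by
    rw [Subtype.dist_eq]; exact dist_le_norm_add_norm _ _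
  simp only at hx hy
  linarith

theorem Model.dist_next (M : Model S₁ S₂) (x y : Square S₁ S₂) (s₁ : S₁) (s₂ : S₂) :
    dist (M.next x s₁ s₂) (M.next y s₁ s₂) = M.β * dist x y := by
  have h : (M.next x s₁ s₂).1 - (M.next y s₁ s₂).1 = M.β • (x.1 - y.1) := by
    ext (s | s) <;> simp [Model.next, Square.p₁, Square.p₂] <;> ring
  rw [Subtype.dist_eq, Subtype.dist_eq, dist_eq_norm, dist_eq_norm, h, norm_smul,
    Real.norm_of_nonneg M.β_mem.1.le]

theorem Model.continuous_next (M : Model S₁ S₂) (s₁ : S₁) (s₂ : S₂) :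
    Continuous fun x => M.next x s₁ s₂ := by
  refine LipschitzWith.continuous (K := M.β.toNNReal) (LipschitzWith.of_dist_le_mul fun x y => ?_)
  rw [M.dist_next, Real.coe_toNNReal _ M.β_mem.1.le]

theorem Model.continuous_profileProb (M : Model S₁ S₂) (s₁ : S₁) (s₂ : S₂) :
    Continuous fun x => M.profileProb x s₁ s₂ := by
  unfold Model.profileProb playProb Square.p₁ Square.p₂
  fun_prop

/-- The probability is a polynomial in the coordinates, hence `C¹`, hence Lipschitz on the compact
product of simplices. -/
theorem Model.exists_lipschitz_profileProb (M : Model S₁ S₂) (s₁ : S₁) (s₂ : S₂) :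
    ∃ L : ℝ, ∀ x y, |M.profileProb x s₁ s₂ - M.profileProb y s₁ s₂| ≤ L * dist x y := by
  have hc : ContDiff ℝ 1 fun x : EuclideanSpace ℝ (S₁ ⊕ S₂) =>
      playProb M.u₁ M.k M.ε (fun s => x (Sum.inr s)) s₁ *
        playProb (fun b a => M.u₂ a b) M.k M.ε (fun s => x (Sum.inl s)) s₂ := by
    unfold playProb
    fun_prop
  obtain ⟨L, hL⟩ := hc.locallyLipschitz.locallyLipschitzOn.exists_lipschitzOnWith_of_compact
    (isCompact_square (S₁ := S₁) (S₂ := S₂))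
  refine ⟨L, fun x y => ?_⟩
  have := hL.dist_le_mul x.1 x.2 y.1 y.2
  rwa [Real.dist_eq] at this

theorem Model.kernel_eq_finiteKernel (M : Model S₁ S₂) :
    M.kernel = finiteKernel (fun (s : S₁ × S₂) x => M.profileProb x s.1 s.2)
      (fun s x => M.next x s.1 s.2) (fun s => M.measurable_profileProb s.1 s.2)
      (fun s => M.measurable_next s.1 s.2) := by
  refine Kernel.ext fun x => ?_
  exact (Fintype.sum_prod_type fun s : S₁ × S₂ =>
    ENNReal.ofReal (M.profileProb x s.1 s.2) • Measure.dirac (M.next x s.1 s.2)).symm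

theorem Model.le_profileProb (M : Model S₁ S₂) (x : Square S₁ S₂) (s₁ : S₁) (s₂ : S₂) :
    M.ε / Fintype.card S₁ * (M.ε / Fintype.card S₂) ≤ M.profileProb x s₁ s₂ := by
  have hε := M.ε_mem.1
  have h1 : _ ≤ playProb M.u₁ M.k M.ε x.p₂ s₁ := le_playProb x.2.2 M.ε_mem.2 s₁
  have h2 : _ ≤ playProb (fun b a => M.u₂ a b) M.k M.ε x.p₁ s₂ :=
    le_playProb x.2.1 M.ε_mem.2 s₂
  exact mul_le_mul h1 h2 (by positivity) (le_trans (by positivity) h1)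

theorem Model.sum_profileProb [Nonempty S₁] [Nonempty S₂] (M : Model S₁ S₂) (x : Square S₁ S₂) :
    ∑ s : S₁ × S₂, M.profileProb x s.1 s.2 = 1 := by
  have h1 : ∑ s, playProb M.u₁ M.k M.ε x.p₂ s = 1 := sum_playProb x.2.2
  have h2 : ∑ s, playProb (fun b a => M.u₂ a b) M.k M.ε x.p₁ s = 1 := sum_playProb x.2.1
  rw [Fintype.sum_prod_type]
  simp only [Model.profileProb, ← Finset.mul_sum, h2, mul_one, h1]

theorem Model.isMarkovKernel_kernel [Nonempty S₁] [Nonempty S₂] (M : Model S₁ S₂) :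
    IsMarkovKernel M.kernel := by
  have hε := M.ε_mem.1
  rw [M.kernel_eq_finiteKernel]
  exact isMarkovKernel_finiteKernel
    (fun s x => le_trans (by positivity) (M.le_profileProb x s.1 s.2)) M.sum_profileProb

theorem Model.exists_boundedContinuous_lintegral_kernel (M : Model S₁ S₂)
    (f : BoundedContinuousFunction (Square S₁ S₂) NNReal) :
    ∃ g : BoundedContinuousFunction (Square S₁ S₂) NNReal,
      ∀ x, ∫⁻ y, f y ∂(M.kernel x) = g x := by
  rw [M.kernel_eq_finiteKernel]
  refine exists_boundedContinuous_lintegral_finiteKernel ?_ ?_ _ _ f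
  · exact fun s => M.continuous_profileProb s.1 s.2
  · exact fun s => M.continuous_next s.1 s.2

theorem Model.exists_mixesGeometrically_kernel [Nonempty S₁] [Nonempty S₂] (M : Model S₁ S₂)
    (hε : 0 < M.ε) {D : ℝ} (hD0 : 0 < D) (hD : ∀ x y : Square S₁ S₂, dist x y ≤ D) :
    ∃ θ ∈ Set.Ioo (0 : ℝ) 1, MixesGeometrically M.kernel (2 * D) θ := by
  choose L hL using fun s : S₁ × S₂ => M.exists_lipschitz_profileProb s.1 s.2
  have hLe : ∀ s, L s ≤ ∑ t, |L t| := fun s => (le_abs_self _).trans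
    (Finset.single_le_sum (f := fun t => |L t|) (fun _ _ => abs_nonneg _) (Finset.mem_univ s))
  rw [M.kernel_eq_finiteKernel]
  refine exists_mixesGeometrically (L := ∑ t, |L t|) (β := M.β)
    (δ := M.ε / Fintype.card S₁ * (M.ε / Fintype.card S₂)) M.β_mem (by positivity)
    ?_ M.sum_profileProb ?_ ?_ hD0 hD _ _
  · exact fun s x => M.le_profileProb x s.1 s.2
  · exact fun s x y => (hL s x y).trans (mul_le_mul_of_nonneg_right (hLe s) dist_nonneg)
  · exact fun s x y => (M.dist_next x y s.1 s.2).le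

end Chain

end RWS

end

theorem theorem1 :
    ∃ c : ℝ → ℝ → ℝ, (∀ R α, 0 < c R α) ∧
      ∀ (S₁ S₂ : Type*) [Fintype S₁] [Fintype S₂] [Nonempty S₁] [Nonempty S₂]
        (M : RWS.Model S₁ S₂),
        0 < M.ε →
        M.β ∈ Set.Ioo (1 - ((max (Fintype.card S₁) (Fintype.card S₂) : ℕ) : ℝ)⁻¹) 1 →
        ∃ θ ∈ Set.Ioo (0 : ℝ) 1, ∃ μ : Measure (RWS.Square S₁ S₂),
          (IsProbabilityMeasure μ ∧ M.kernel.Invariant μ) ∧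
          (∀ μ' : Measure (RWS.Square S₁ S₂),
            IsProbabilityMeasure μ' → M.kernel.Invariant μ' → μ' = μ) ∧
          ∀ α : ℝ, 1 ≤ α → ∀ ν : Measure (RWS.Square S₁ S₂), IsProbabilityMeasure ν → ∀ n : ℕ,
            RWS.wasserstein α (ν.bind ⇑(M.kernel ^ n)) μ ^ α ≤
              ENNReal.ofReal (c (⨆ x : RWS.Square S₁ S₂, ‖(x : EuclideanSpace ℝ (S₁ ⊕ S₂))‖) α
                * θ ^ n) := by
  -- With `D = 2 * |R| + 1`, this is the mixing constant `2 * D` times the factor `D ^ (α - 1)` from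
  -- passing to order `α`.
  refine ⟨fun R α => 2 * (2 * |R| + 1) ^ α, fun R α => by positivity, ?_⟩
  intro S₁ S₂ _ _ _ _ M hε _
  have hMarkov := M.isMarkovKernel_kernel
  have hD0 : 0 < 2 * |⨆ x : RWS.Square S₁ S₂, ‖(x : EuclideanSpace ℝ (S₁ ⊕ S₂))‖| + 1 := by
    positivity
  obtain ⟨θ, hθ, hmix⟩ := M.exists_mixesGeometrically_kernel hε hD0 RWS.dist_square_le
  obtain ⟨μ, hμ, hinv⟩ := hmix.exists_invariant hθ M.exists_boundedContinuous_lintegral_kernel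
  refine ⟨θ, hθ, μ, ⟨hμ, hinv⟩, fun μ' _ hinv' => hmix.invariant_unique hθ hinv hinv',
    fun α hα ν _ n => ?_⟩
  refine (hmix.wasserstein_rpow_le hD0 RWS.dist_square_le hinv hα ν n).trans_eq ?_
  congr 1
  rw [Real.rpow_sub_one hD0.ne']
  field_simp
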